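/- Let $D\subset\mathbb{R}^d$ be a bounded open set, let $D_1,\dots,D_{N_S}\subset D$ be pairwise disjoint open sets that cover $D$ up to a set of Lebesgue measure zero, and let $\mathcal{O}_1,\dots,\mathcal{O}_{N_S}$ be open sets with Lipschitz boundary such that $D_\ell\subset\mathcal{O}_\ell\subset D$ for every $\ell$. Let $H=H^1_0(D)$ and $\widehat{G}=H^1(\mathcal{O}_1)\times\cdots\times H^1(\mathcal{O}_{N_S})$, and let $R:H\to\widehat{G}$, $Rv=(v|_{\mathcal{O}_1},\dots,v|_{\mathcal{O}_{N_S}})$, be the restriction operator. For $\phi=\{\phi_\ell\}$ and $\psi=\{\psi_\ell\}$ in $\widehat{G}$ and $\epsilon>0$ put \[ b(\phi,\psi)=\sum_{\ell=1}^{N_S}\left(\int_{\mathcal{O}_\ell}\nabla\phi_\ell\cdot\nabla\psi_\ell+\int_{\partial\mathcal{O}_\ell}\phi_\ell\psi_\ell\right), \] \[ c_\epsilon(\phi,\psi)=\sum_{\ell=1}^{N_S}\int_{D_\ell}\nabla\phi_\ell\cdot\nabla\psi_\ell+\epsilon\sum_{\ell=1}^{N_S}\int_{\mathcal{O}_\ell\setminus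 D_\ell}\nabla\phi_\ell\cdot\nabla\psi_\ell+\sum_{\ell=1}^{N_S}\int_{\partial\mathcal{O}_\ell}\phi_\ell\psi_\ell, \] where the boundary integrals are taken with respect to surface measure and the functions in them are understood as traces. Let \[ \nu=\max_{1\le j\le N_S}\#\{i:\mathcal{O}_i\cap\mathcal{O}_j\neq\emptyset\}. \] Then for every $\epsilon>0$ and every $v\in H$, \[ b(Rv,Rv)\le\nu\,c_\epsilon(Rv,Rv). \] Equivalently, the inequality $b(\psi,\psi)\le r_1^2\,c_\epsilon(\psi,\psi)$ holds for all $\psi$ in the range of $R$ with $r_1=\sqrt{\nu}$. -/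

import Mathlib

open MeasureTheory Filter Topology
open scoped ContDiff InnerProductSpace

noncomputable section

/-- Euclidean space `ℝ^d`. -/
abbrev Eucl (d : ℕ) : Type := EuclideanSpace ℝ (Fin d)

/-- Smooth functions on `ℝ^d` with compact support contained in `Ω`, i.e. `C_c^∞(Ω)`. -/
structure IsTest {d : ℕ} (Ω : Set (Eucl d)) (φ : Eucl d → ℝ) : Prop where
  smooth : ContDiff ℝ ∞ φ
  compact : HasCompactSupport φ
  support : tsupport φ ⊆ Ω

theorem IsTest.mono {d : ℕ} {O D : Set (Eucl d)} (h : O ⊆ D) {φ : Eucl d → ℝ}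
    (hφ : IsTest O φ) : IsTest D φ :=
  ⟨hφ.smooth, hφ.compact, hφ.support.trans h⟩

theorem IsTest.zero {d : ℕ} (Ω : Set (Eucl d)) : IsTest Ω (fun _ => 0) :=
  ⟨contDiff_const, HasCompactSupport.zero, by
    have h : tsupport (fun _ : Eucl d => (0 : ℝ)) = ∅ := tsupport_eq_empty_iff.2 rfl
    rw [h]; exact Set.empty_subset _⟩

theorem IsTest.add {d : ℕ} {Ω : Set (Eucl d)} {φ ψ : Eucl d → ℝ}
    (hφ : IsTest Ω φ) (hψ : IsTest Ω ψ) : IsTest Ω (φ + ψ) :=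
  ⟨hφ.smooth.add hψ.smooth, hφ.compact.add hψ.compact,
    (tsupport_add φ ψ).trans (Set.union_subset hφ.support hψ.support)⟩

theorem IsTest.smul {d : ℕ} {Ω : Set (Eucl d)} {φ : Eucl d → ℝ} (c : ℝ)
    (hφ : IsTest Ω φ) : IsTest Ω (c • φ) :=
  ⟨contDiff_const.smul hφ.smooth, hφ.compact.smul_left (f := fun _ => c),
    (tsupport_smul_subset_right (fun _ => c) φ).trans hφ.support⟩

theorem IsTest.memLp {d : ℕ} {Ω : Set (Eucl d)} {φ : Eucl d → ℝ} (hφ : IsTest Ω φ)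
    (S : Set (Eucl d)) : MemLp φ 2 (volume.restrict S) :=
  hφ.smooth.continuous.memLp_of_hasCompactSupport hφ.compact

theorem IsTest.memLp_fderiv {d : ℕ} {Ω : Set (Eucl d)} {φ : Eucl d → ℝ} (hφ : IsTest Ω φ)
    (e : Eucl d) (S : Set (Eucl d)) :
    MemLp (fun x => fderiv ℝ φ x e) 2 (volume.restrict S) :=
  Continuous.memLp_of_hasCompactSupport
    ((hφ.smooth.continuous_fderiv (by simp)).clm_apply continuous_const)
    (hφ.compact.fderiv_apply (𝕜 := ℝ) e)

/-- `g` is the weak gradient of `u` on `Ω`. -/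
def HasWeakGradient {d : ℕ} (Ω : Set (Eucl d)) (u : Eucl d → ℝ) (g : Eucl d → Eucl d) : Prop :=
  ∀ φ : Eucl d → ℝ, IsTest Ω φ → ∀ e : Eucl d,
    ∫ x in Ω, u x * fderiv ℝ φ x e = -∫ x in Ω, ⟪g x, e⟫_ℝ * φ x

/-- The Hilbert space `L²(Ω) × L²(Ω; ℝ^d)`. -/
abbrev GradPair {d : ℕ} (Ω : Set (Eucl d)) : Type :=
  WithLp 2 (Lp ℝ 2 (volume.restrict Ω) × Lp (Eucl d) 2 (volume.restrict Ω))

/-- The Sobolev space `H¹(Ω)`: an element is a function in `L²(Ω)` stored together with its weak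
gradient, required to be in `L²(Ω)`. The inherited norm is the usual `H¹` norm. -/
def H1 {d : ℕ} (Ω : Set (Eucl d)) : Submodule ℝ (GradPair Ω) where
  carrier := {p | HasWeakGradient Ω p.fst p.snd}
  zero_mem' := by
    intro φ hφ e
    rw [integral_eq_zero_of_ae, integral_eq_zero_of_ae, neg_zero]
    · filter_upwards [Lp.coeFn_zero (Eucl d) 2 (volume.restrict Ω)] with x hx
      have : ((0 : GradPair Ω).snd : Eucl d → Eucl d) x = 0 := hx
      rw [this, inner_zero_left, zero_mul]; rfl
    · filter_upwards [Lp.coeFn_zero ℝ 2 (volume.restrict Ω)] with x hx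
      have : ((0 : GradPair Ω).fst : Eucl d → ℝ) x = 0 := hx
      rw [this, zero_mul]; rfl
  add_mem' := by
    intro p q hp hq φ hφ e
    have h1 := hp φ hφ e
    have h2 := hq φ hφ e
    have i1 : ∀ p : GradPair Ω, Integrable (fun x => p.fst x * fderiv ℝ φ x e)
        (volume.restrict Ω) := fun p => (Lp.memLp p.fst).integrable_mul (hφ.memLp_fderiv e Ω)
    have i2 : ∀ p : GradPair Ω, Integrable (fun x => ⟪p.snd x, e⟫_ℝ * φ x)
        (volume.restrict Ω) :=
      fun p => ((Lp.memLp p.snd).inner_const (𝕜 := ℝ) e).integrable_mul (hφ.memLp Ω)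
    have e1 : ∫ x in Ω, (p + q).fst x * fderiv ℝ φ x e
        = ∫ x in Ω, (p.fst x * fderiv ℝ φ x e + q.fst x * fderiv ℝ φ x e) := by
      refine integral_congr_ae ?_
      filter_upwards [Lp.coeFn_add p.fst q.fst] with x hx
      have : (p + q).fst x = p.fst x + q.fst x := hx
      rw [this]; ring
    have e2 : ∫ x in Ω, ⟪(p + q).snd x, e⟫_ℝ * φ x
        = ∫ x in Ω, (⟪p.snd x, e⟫_ℝ * φ x + ⟪q.snd x, e⟫_ℝ * φ x) := by
      refine integral_congr_ae ?_
      filter_upwards [Lp.coeFn_add p.snd q.snd] with x hx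
      have : (p + q).snd x = p.snd x + q.snd x := hx
      rw [this, inner_add_left]; ring
    rw [e1, e2, integral_add (i1 p) (i1 q), integral_add (i2 p) (i2 q), h1, h2]
    ring
  smul_mem' := by
    intro c p hp φ hφ e
    have h1 := hp φ hφ e
    have e1 : ∫ x in Ω, (c • p).fst x * fderiv ℝ φ x e
        = ∫ x in Ω, c * (p.fst x * fderiv ℝ φ x e) := by
      refine integral_congr_ae ?_
      filter_upwards [Lp.coeFn_smul c p.fst] with x hx
      have : (c • p).fst x = c * p.fst x := hx
      rw [this]; ring
    have e2 : ∫ x in Ω, ⟪(c • p).snd x, e⟫_ℝ * φ x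
        = ∫ x in Ω, c * (⟪p.snd x, e⟫_ℝ * φ x) := by
      refine integral_congr_ae ?_
      filter_upwards [Lp.coeFn_smul c p.snd] with x hx
      have : (c • p).snd x = c • p.snd x := hx
      rw [this, real_inner_smul_left]; ring
    rw [e1, e2, integral_const_mul, integral_const_mul, h1]
    ring

/-- A representative of the function underlying an element of `H¹(Ω)`. -/
def H1.fn {d : ℕ} {Ω : Set (Eucl d)} (u : H1 Ω) : Eucl d → ℝ := u.1.fst

/-- A representative of the weak gradient of an element of `H¹(Ω)`. -/
def H1.grad {d : ℕ} {Ω : Set (Eucl d)} (u : H1 Ω) : Eucl d → Eucl d := u.1.snd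

/-- The subspace of (classes of) functions in `C_c^∞(Ω)` in `H¹(Ω)`. -/
def H1.test {d : ℕ} (Ω : Set (Eucl d)) : Submodule ℝ (H1 Ω) where
  carrier := {u | ∃ φ, IsTest Ω φ ∧ H1.fn u =ᵐ[volume.restrict Ω] φ}
  zero_mem' := ⟨_, IsTest.zero Ω, Lp.coeFn_zero ℝ 2 (volume.restrict Ω)⟩
  add_mem' := by
    rintro u v ⟨φ, hφ, hu⟩ ⟨ψ, hψ, hv⟩
    exact ⟨φ + ψ, hφ.add hψ, (Lp.coeFn_add u.1.fst v.1.fst).trans (hu.add hv)⟩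
  smul_mem' := by
    rintro c u ⟨φ, hφ, hu⟩
    exact ⟨c • φ, hφ.smul c, (Lp.coeFn_smul c u.1.fst).trans (hu.const_smul c)⟩

/-- `H¹₀(Ω)`: the closure of `C_c^∞(Ω)` in `H¹(Ω)`. -/
def H10 {d : ℕ} (Ω : Set (Eucl d)) : Submodule ℝ (H1 Ω) := (H1.test Ω).topologicalClosure

/-- Restriction `L²(D; F) → L²(O; F)` for `O ⊆ D`. -/
def lpRestrict {d : ℕ} {F : Type*} [NormedAddCommGroup F] [NormedSpace ℝ F]
    {O D : Set (Eucl d)} (h : O ⊆ D) :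
    Lp F 2 (volume.restrict D) →ₗ[ℝ] Lp F 2 (volume.restrict O) where
  toFun f := ((Lp.memLp f).mono_measure (Measure.restrict_mono h le_rfl)).toLp f
  map_add' f g := by
    rw [← MemLp.toLp_add, MemLp.toLp_eq_toLp_iff]
    exact ae_mono (Measure.restrict_mono h le_rfl) (Lp.coeFn_add f g)
  map_smul' c f := by
    rw [RingHom.id_apply, ← MemLp.toLp_const_smul, MemLp.toLp_eq_toLp_iff]
    exact ae_mono (Measure.restrict_mono h le_rfl) (Lp.coeFn_smul c f)

theorem lpRestrict_coeFn {d : ℕ} {F : Type*} [NormedAddCommGroup F] [NormedSpace ℝ F]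
    {O D : Set (Eucl d)} (h : O ⊆ D) (f : Lp F 2 (volume.restrict D)) :
    (lpRestrict h f : Eucl d → F) =ᵐ[volume.restrict O] f :=
  MemLp.coeFn_toLp ((Lp.memLp f).mono_measure (Measure.restrict_mono h le_rfl))

theorem HasWeakGradient.restrict {d : ℕ} {O D : Set (Eucl d)} (h : O ⊆ D)
    {u : Eucl d → ℝ} {g : Eucl d → Eucl d} (hug : HasWeakGradient D u g) :
    HasWeakGradient O u g := by
  intro φ hφ e
  have key : ∀ f : Eucl d → ℝ, (∀ x, x ∉ tsupport φ → f x = 0) →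
      ∫ x in O, f x = ∫ x in D, f x := by
    intro f hf
    rw [setIntegral_eq_integral_of_forall_compl_eq_zero,
      setIntegral_eq_integral_of_forall_compl_eq_zero]
    · exact fun x hx => hf x fun hx' => hx (h (hφ.support hx'))
    · exact fun x hx => hf x fun hx' => hx (hφ.support hx')
  rw [key, key]
  · exact hug φ (hφ.mono h) e
  · intro x hx
    rw [image_eq_zero_of_notMem_tsupport hx, mul_zero]
  · intro x hx
    have : fderiv ℝ φ x = 0 :=
      image_eq_zero_of_notMem_tsupport fun hx' => hx (tsupport_fderiv_subset ℝ hx')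
    rw [this]; simp

/-- Restriction of a function and of its weak gradient from `D` to `O ⊆ D`. -/
def gradPairRestrict {d : ℕ} {O D : Set (Eucl d)} (h : O ⊆ D) : GradPair D →ₗ[ℝ] GradPair O :=
  (WithLp.linearEquiv 2 ℝ _).symm.toLinearMap ∘ₗ
    ((lpRestrict h).prodMap (lpRestrict h)) ∘ₗ (WithLp.linearEquiv 2 ℝ _).toLinearMap

theorem gradPairRestrict_mem {d : ℕ} {O D : Set (Eucl d)} (h : O ⊆ D) (p : GradPair D)
    (hp : p ∈ H1 D) : gradPairRestrict h p ∈ H1 O := by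
  intro φ hφ e
  have hf : ((gradPairRestrict h p).fst : Eucl d → ℝ) =ᵐ[volume.restrict O] p.fst :=
    lpRestrict_coeFn h p.fst
  have hg : ((gradPairRestrict h p).snd : Eucl d → Eucl d) =ᵐ[volume.restrict O] p.snd :=
    lpRestrict_coeFn h p.snd
  have e1 : ∫ x in O, (gradPairRestrict h p).fst x * fderiv ℝ φ x e
      = ∫ x in O, p.fst x * fderiv ℝ φ x e :=
    integral_congr_ae (hf.mono fun x hx => by simp only [hx])
  have e2 : ∫ x in O, ⟪(gradPairRestrict h p).snd x, e⟫_ℝ * φ x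
      = ∫ x in O, ⟪p.snd x, e⟫_ℝ * φ x :=
    integral_congr_ae (hg.mono fun x hx => by simp only [hx])
  rw [e1, e2]
  exact HasWeakGradient.restrict h hp φ hφ e

/-- Restriction `H¹(D) → H¹(O)`, `u ↦ u|_O`, for `O ⊆ D`. -/
def H1.restrict {d : ℕ} {O D : Set (Eucl d)} (h : O ⊆ D) : H1 D →ₗ[ℝ] H1 O :=
  (gradPairRestrict h).restrict (gradPairRestrict_mem h)

/-- `Ω` is a Lipschitz open set: near each boundary point, in suitable orthogonal coordinates
(`e` the vertical unit vector), `Ω` is the set of points strictly above the graph of a Lipschitz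
function. -/
def IsLipschitzOpen {d : ℕ} (Ω : Set (Eucl d)) : Prop :=
  IsOpen Ω ∧ ∀ p ∈ frontier Ω, ∃ e : Eucl d, ‖e‖ = 1 ∧
    ∃ (K : NNReal) (γ : (ℝ ∙ e)ᗮ → ℝ), LipschitzWith K γ ∧
      ∀ᶠ x in 𝓝 p, (x ∈ Ω ↔ γ ((ℝ ∙ e)ᗮ.orthogonalProjectionOnto x) < ⟪e, x⟫_ℝ)

/-- Surface measure on `∂Ω`: the `(d-1)`-dimensional Hausdorff measure, normalised to agree with
Lebesgue measure on hyperplanes. -/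
def surfaceMeasure {d : ℕ} (Ω : Set (Eucl d)) : Measure (Eucl d) :=
  (Measure.euclideanHausdorffMeasure (d - 1)).restrict (frontier Ω)

/-- `g ∈ L²(∂Ω)` is a trace of `u ∈ H¹(Ω)`: the pair `(u, g)` is a limit, in `H¹(Ω) × L²(∂Ω)`, of
pairs `(φ|_Ω, φ|_∂Ω)` with `φ ∈ C_c^∞(ℝ^d)`. -/
def IsTrace {d : ℕ} (Ω : Set (Eucl d)) (u : H1 Ω) (g : Lp ℝ 2 (surfaceMeasure Ω)) : Prop :=
  (u, g) ∈ closure {p : H1 Ω × Lp ℝ 2 (surfaceMeasure Ω) |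
    ∃ φ : Eucl d → ℝ, IsTest Set.univ φ ∧ H1.fn p.1 =ᵐ[volume.restrict Ω] φ ∧
      (p.2 : Eucl d → ℝ) =ᵐ[surfaceMeasure Ω] φ}

open Classical in
/-- The trace on `∂Ω` of `u ∈ H¹(Ω)`. For bounded Lipschitz `Ω` a trace exists and is unique by
the trace theorem; the value `0` is a default that is not used in that case. -/
def trace {d : ℕ} {Ω : Set (Eucl d)} (u : H1 Ω) : Lp ℝ 2 (surfaceMeasure Ω) :=
  if h : ∃ g, IsTrace Ω u g then h.choose else 0

/-- A bounded domain `D ⊆ ℝ^d`, a non-overlapping partition of it (up to a null set) into open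
subdomains `D_1, …, D_N`, and an overlapping decomposition into Lipschitz subdomains
`O_1, …, O_N` of `D` with `D_ℓ ⊆ O_ℓ`. -/
structure OverlappingDecomposition (d N : ℕ) where
  D : Set (Eucl d)
  isOpen_D : IsOpen D
  bounded_D : Bornology.IsBounded D
  sub : Fin N → Set (Eucl d)
  isOpen_sub : ∀ l, IsOpen (sub l)
  disjoint_sub : Pairwise fun l k => Disjoint (sub l) (sub k)
  cover : volume (D \ ⋃ l, sub l) = 0
  ovl : Fin N → Set (Eucl d)
  lipschitz_ovl : ∀ l, IsLipschitzOpen (ovl l)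
  sub_subset_ovl : ∀ l, sub l ⊆ ovl l
  ovl_subset_D : ∀ l, ovl l ⊆ D

namespace OverlappingDecomposition

variable {d N : ℕ} (X : OverlappingDecomposition d N)

/-- The space `H = H¹₀(D)`. -/
abbrev H : Type := H10 X.D

/-- The space `Ĝ = H¹(O_1) × ⋯ × H¹(O_N)`. -/
abbrev Ghat : Type := (l : Fin N) → H1 (X.ovl l)

/-- The restriction operator `R : H → Ĝ`, `R u = (u|_{O_1}, …, u|_{O_N})`. -/
def R : X.H →ₗ[ℝ] X.Ghat :=
  LinearMap.pi fun l => (H1.restrict (X.ovl_subset_D l)).comp (H10 X.D).subtype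

/-- `b_l^∂(v, w) = ∫_{∂O_l} v w`. -/
def bBdry (l : Fin N) (v w : H1 (X.ovl l)) : ℝ :=
  ∫ x, trace v x * trace w x ∂(surfaceMeasure (X.ovl l))

/-- `b(v, w) = ∑_l (∫_{O_l} ∇v_l · ∇w_l + ∫_{∂O_l} v_l w_l)`. -/
def b (v w : X.Ghat) : ℝ :=
  ∑ l, ((∫ x in X.ovl l, ⟪H1.grad (v l) x, H1.grad (w l) x⟫_ℝ) + X.bBdry l (v l) (w l))

/-- `c_ε(v, w) = ∑_l ∫_{D_l} ∇v_l · ∇w_l + ε ∑_l ∫_{O_l \ D_l} ∇v_l · ∇w_l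
  + ∑_l ∫_{∂O_l} v_l w_l`. -/
def c (ε : ℝ) (v w : X.Ghat) : ℝ :=
  (∑ l, ∫ x in X.sub l, ⟪H1.grad (v l) x, H1.grad (w l) x⟫_ℝ)
    + ε * (∑ l, ∫ x in X.ovl l \ X.sub l, ⟪H1.grad (v l) x, H1.grad (w l) x⟫_ℝ)
    + ∑ l, X.bBdry l (v l) (w l)

/-- The indices of the overlapping subdomains that meet `O_j` (including `j` itself). -/
def neigh (j : Fin N) : Set (Fin N) := {i | (X.ovl i ∩ X.ovl j).Nonempty}

/-- `ν = max_j # Neigh(j)`. -/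
def nu : ℕ := Finset.univ.sup fun j => (X.neigh j).ncard

end OverlappingDecomposition

end

/-!
On the range of `R` all components of `ψ = R v` have gradients that are restrictions of the single
function `g = ∇v`, so the bulk terms of `b` and `c_ε` are integrals of `|g|²`. Up to a null set,
`O_l` is the disjoint union of the sets `O_l ∩ D_k`, hence
`∑_l ∫_{O_l} |g|² = ∑_k ∑_l ∫_{O_l ∩ D_k} |g|²`. For fixed `k` the inner summand vanishes unless
`O_l` meets `D_k ⊆ O_k`, i.e. unless `l` is a neighbour of `k`, and is otherwise at most
`∫_{D_k} |g|²`; there are at most `ν` neighbours. This is `sum_setIntegral_ovl_le`.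

The `ε`-term of `c_ε` is nonnegative and can be dropped. The boundary terms are the same
nonnegative numbers on both sides, so they satisfy the inequality when `ν ≥ 1`; when `ν = 0`, every
`O_l` is empty and they vanish.
-/

namespace OverlappingDecomposition

variable {d N : ℕ} (X : OverlappingDecomposition d N)

theorem ncard_neigh_le_nu (k : Fin N) : (X.neigh k).ncard ≤ X.nu :=
  Finset.le_sup (f := fun j => (X.neigh j).ncard) (Finset.mem_univ k)

theorem sub_subset_D (l : Fin N) : X.sub l ⊆ X.D :=
  (X.sub_subset_ovl l).trans (X.ovl_subset_D l)

/-- The sets `D_k` cut `O_l` into disjoint pieces, up to a null set. -/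
theorem setIntegral_ovl_eq_sum {f : Eucl d → ℝ} (hf : IntegrableOn f X.D) (l : Fin N) :
    ∫ x in X.ovl l, f x = ∑ k, ∫ x in X.ovl l ∩ X.sub k, f x := by
  have hae : (X.ovl l : Set (Eucl d)) =ᵐ[volume] ⋃ k, X.ovl l ∩ X.sub k := by
    rw [← Set.inter_iUnion]
    refine Filter.EventuallyLE.antisymm ?_ Set.inter_subset_left.eventuallyLE
    rw [ae_le_set, Set.sdiff_self_inter]
    exact measure_mono_null (Set.sdiff_subset_sdiff_left (X.ovl_subset_D l)) X.cover
  rw [setIntegral_congr_set hae]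
  refine integral_iUnion_fintype
    (fun k => ((X.lipschitz_ovl l).1.inter (X.isOpen_sub k)).measurableSet) ?_
    fun k => hf.mono_set (Set.inter_subset_left.trans (X.ovl_subset_D l))
  exact fun i j hij => (X.disjoint_sub hij).mono Set.inter_subset_right Set.inter_subset_right

open Classical in
/-- The finite overlap bound: each `D_k` is counted at most `ν` times by the sets `O_l`. -/
theorem sum_setIntegral_ovl_le {f : Eucl d → ℝ} (hf : IntegrableOn f X.D) (h0 : ∀ x, 0 ≤ f x) :
    ∑ l, ∫ x in X.ovl l, f x ≤ (X.nu : ℝ) * ∑ k, ∫ x in X.sub k, f x := by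
  simp_rw [X.setIntegral_ovl_eq_sum hf]
  rw [Finset.sum_comm, Finset.mul_sum]
  refine Finset.sum_le_sum fun k _ => ?_
  have hk : 0 ≤ ∫ x in X.sub k, f x := integral_nonneg h0
  calc ∑ l, ∫ x in X.ovl l ∩ X.sub k, f x
      ≤ ∑ l, if l ∈ X.neigh k then ∫ x in X.sub k, f x else 0 := by
        refine Finset.sum_le_sum fun l _ => ?_
        split_ifs with hl
        · exact setIntegral_mono_set (hf.mono_set (X.sub_subset_D k)) (ae_of_all _ h0)
            Set.inter_subset_right.eventuallyLE
        · have hempty : X.ovl l ∩ X.sub k = ∅ :=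
            Set.not_nonempty_iff_eq_empty.1 fun h =>
              hl (h.mono (Set.inter_subset_inter_right _ (X.sub_subset_ovl k)))
          simp [hempty]
    _ = ((X.neigh k).ncard : ℝ) * ∫ x in X.sub k, f x := by
        rw [← Finset.sum_filter, Finset.sum_const, nsmul_eq_mul, ← Set.ncard_coe_finset]
        simp
    _ ≤ (X.nu : ℝ) * ∫ x in X.sub k, f x := by
        gcongr
        exact X.ncard_neigh_le_nu k

theorem ovl_eq_empty_of_nu_eq_zero (h : X.nu = 0) (l : Fin N) : X.ovl l = ∅ := by
  have h0 : (X.neigh l).ncard = 0 := Nat.le_zero.1 (h ▸ X.ncard_neigh_le_nu l)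
  rw [Set.ncard_eq_zero] at h0
  by_contra hne
  have hl : l ∈ X.neigh l := by
    simpa [neigh] using Set.nonempty_iff_ne_empty.2 hne
  simp [h0] at hl

theorem bBdry_self_nonneg (l : Fin N) (v : H1 (X.ovl l)) : 0 ≤ X.bBdry l v v :=
  integral_nonneg fun _ => mul_self_nonneg _

theorem bBdry_self_le_nu_mul (l : Fin N) (v : H1 (X.ovl l)) :
    X.bBdry l v v ≤ (X.nu : ℝ) * X.bBdry l v v := by
  rcases Nat.eq_zero_or_pos X.nu with h | h
  · have hμ : surfaceMeasure (X.ovl l) = 0 := by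
      simp [surfaceMeasure, X.ovl_eq_empty_of_nu_eq_zero h l]
    have hint : ∀ f : Eucl d → ℝ, ∫ x, f x ∂(surfaceMeasure (X.ovl l)) = 0 := fun f => by
      rw [hμ, integral_zero_measure]
    have : X.bBdry l v v = 0 := hint _
    simp [this]
  · exact le_mul_of_one_le_left (X.bBdry_self_nonneg l v) (by exact_mod_cast h)

theorem grad_R_ae_eq (v : X.H) (l : Fin N) :
    H1.grad (X.R v l) =ᵐ[volume.restrict (X.ovl l)] H1.grad v.1 :=
  lpRestrict_coeFn (X.ovl_subset_D l) v.1.1.snd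

theorem setIntegral_grad_R (v : X.H) (l : Fin N) {S : Set (Eucl d)} (hS : S ⊆ X.ovl l) :
    ∫ x in S, ⟪H1.grad (X.R v l) x, H1.grad (X.R v l) x⟫_ℝ
      = ∫ x in S, ⟪H1.grad v.1 x, H1.grad v.1 x⟫_ℝ := by
  refine integral_congr_ae ?_
  filter_upwards [ae_mono (Measure.restrict_mono hS le_rfl) (X.grad_R_ae_eq v l)] with x hx
  rw [hx]

theorem b_R_le (ε : ℝ) (hε : 0 ≤ ε) (v : X.H) :
    X.b (X.R v) (X.R v) ≤ (X.nu : ℝ) * X.c ε (X.R v) (X.R v) := by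
  have hint : IntegrableOn (fun x => ⟪H1.grad v.1 x, H1.grad v.1 x⟫_ℝ) X.D :=
    L2.integrable_inner v.1.1.snd v.1.1.snd
  have hbulk := X.sum_setIntegral_ovl_le hint fun _ => real_inner_self_nonneg
  have hbdry : ∑ l, X.bBdry l (X.R v l) (X.R v l)
      ≤ (X.nu : ℝ) * ∑ l, X.bBdry l (X.R v l) (X.R v l) := by
    rw [Finset.mul_sum]
    exact Finset.sum_le_sum fun l _ => X.bBdry_self_le_nu_mul l _
  have hrest : 0 ≤ (X.nu : ℝ) * (ε * ∑ l, ∫ x in X.ovl l \ X.sub l,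
      ⟪H1.grad (X.R v l) x, H1.grad (X.R v l) x⟫_ℝ) :=
    mul_nonneg (Nat.cast_nonneg _) (mul_nonneg hε (Finset.sum_nonneg fun l _ =>
      integral_nonneg fun _ => real_inner_self_nonneg))
  have hovl := fun l => X.setIntegral_grad_R v l subset_rfl
  have hsub := fun l => X.setIntegral_grad_R v l (X.sub_subset_ovl l)
  rw [b, c, Finset.sum_add_distrib]
  simp only [hovl, hsub]
  linarith

end OverlappingDecomposition

theorem mainTheorem11 {d N : ℕ} (X : OverlappingDecomposition d N) (ε : ℝ) (hε : 0 < ε) :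
    (∀ v : X.H, X.b (X.R v) (X.R v) ≤ (X.nu : ℝ) * X.c ε (X.R v) (X.R v)) ∧
    (∀ ψ ∈ LinearMap.range X.R, X.b ψ ψ ≤ Real.sqrt (X.nu : ℝ) ^ 2 * X.c ε ψ ψ) := by
  refine ⟨X.b_R_le ε hε.le, ?_⟩
  rintro _ ⟨v, rfl⟩
  rw [Real.sq_sqrt (Nat.cast_nonneg _)]
  exact X.b_R_le ε hε.le v
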